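/- Let $\mathrm{Var}$ be a countably infinite set of variables, let $\mathscr F$ be the full subcategory of $\mathrm{Set}$ on the finite subsets $\Gamma\subseteq\mathrm{Var}$ (contexts), and let a presheaf be a functor $\mathscr F\to\mathrm{Set}$. Let $V(\Gamma)=\Gamma$ be the presheaf of variables, $(\delta X)(\Gamma)=X(\Gamma+1)$, and let $H_\lambda X=X\times X+\delta X$ on presheaves. For a context $\Gamma$ let $T'_\lambda(\Gamma)$ be the set of all finite and infinite $\lambda$-trees (leaves $x$, binary nodes $@$, unary nodes $\lambda y$, with $x,y\in\mathrm{Var}$) whose free variables lie in $\Gamma$. For finite trees, possibly with leaves labelled by a constant $\bot$, $\alpha$-conversion $\sim_\alpha$ is the least congruence with $\lambda y.t\sim_\alpha\lambda z.t[z/y]$ whenever $z$ is not free in $t$ (the substitution being free of capture). For arbitrary trees, $t\sim_\alpha t'$ means that for every $k\in\mathbb N$ the cuttings $t|_k$ and $t'|_k$ at level $k$ (all nodes at level $k$ replaced by leaves labelled $\bot$) are $\alpha$-equivalent. The presheaf $T_\lambda$ is given by $T_\lambda(\Gamma)=T'_\lambda(\Gamma)/{\sim_\alpha}$; on a map $\gamma\colon\Gamma\to\Gamma'$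 it relabels the bound variables of a tree so that they do not lie in $\Gamma'$ and every free variable $x$ to $\gamma(x)$. Application and abstraction give $\tau\colon H_\lambda T_\lambda\to T_\lambda$, and $i\colon V\to T_\lambda$ is the inclusion of variables. An algebra $a\colon HA\to A$ is completely iterative if for every object $X$ and every $e\colon X\to HX+A$ there is a unique $e^\dagger\colon X\to A$ with $e^\dagger=[a,\mathrm{id}]\cdot(He^\dagger+\mathrm{id})\cdot e$; it is free on $Y$ with universal arrow $\eta\colon Y\to A$ if for every completely iterative algebra $B$ and every $f\colon Y\to B$ there is a unique algebra homomorphism $h\colon A\to B$ with $h\cdot\eta=f$. **Theorem.** $(T_\lambda,\tau)$ with $i\colon V\to T_\lambda$ is the free completely iterative $H_\lambda$-algebra on $V$. Moreover, $[\tau,i]\colon H_\lambda T_\lambda+V\to T_\lambda$ is an isomorphism, and its inverse makes $T_\lambda$ a terminal coalgebra for $H_\lambda(-)+V$. Finally, $T_\lambda$ is the limit of the chain $W_0=1$, $W_{n+1}=H_\lambda W_n+V$ (with $w_0\colon W_1\to W_0$ unique and $w_{n+1}=H_\lambda w_n+\mathrm{id}_V$), with limit maps $\pi_n\colon T_\lambda\to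 W_n$ such that $\pi_{n+1}\cdot[\tau,i]=H_\lambda\pi_n+\mathrm{id}_V$ and which are the cuttings at level $n$: for all $n$ and $\Gamma$ the map $\pi_n\colon T_\lambda(\Gamma)\to W_n(\Gamma)$ is surjective, and for $s,t\in T'_\lambda(\Gamma)$ one has $\pi_n[s]=\pi_n[t]$ if and only if $s|_n\sim_\alpha t|_n$. -/

import Mathlib

open CategoryTheory CategoryTheory.Limits Opposite

universe v w u

noncomputable section

/-! ## Completely iterative algebras, free ones, and the terminal-coalgebra chain -/

section Iterative

variable {C : Type w} [Category.{v} C] [HasBinaryCoproducts C]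

/-- An algebra `a : H A ⟶ A` is completely iterative if every flat equation morphism
`e : X ⟶ H X + A` has a unique solution, i.e. there is a unique `s : X ⟶ A` with
`s = [a, id] ∘ (H s + id) ∘ e`. -/
def IsCIA {H : C ⥤ C} (A : Endofunctor.Algebra H) : Prop :=
  ∀ (X : C) (e : X ⟶ H.obj X ⨿ A.a),
    ∃! s : X ⟶ A.a, s = e ≫ coprod.map (H.map s) (𝟙 A.a) ≫ coprod.desc A.str (𝟙 A.a)

/-- `A` together with `η : Y ⟶ A` is a free completely iterative algebra on `Y`: it is completely
iterative, and every morphism from `Y` to a completely iterative algebra `B` factors through `η` by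
a unique homomorphism of algebras `A ⟶ B`. -/
structure IsFreeCIA {H : C ⥤ C} (A : Endofunctor.Algebra H) {Y : C} (η : Y ⟶ A.a) : Prop where
  isCIA : IsCIA A
  existsUnique_hom : ∀ B : Endofunctor.Algebra H, IsCIA B → ∀ f : Y ⟶ B.a,
    ∃! h : A ⟶ B, η ≫ h.f = f

/-- The endofunctor `H(-) + Y`. -/
@[simps]
def addConst (H : C ⥤ C) (Y : C) : C ⥤ C where
  obj X := H.obj X ⨿ Y
  map f := coprod.map (H.map f) (𝟙 Y)

variable [HasTerminal C]

/-- The objects `W₀ = 1`, `Wₙ₊₁ = G Wₙ` of the terminal-coalgebra chain of `G`. -/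
def chainObj (G : C ⥤ C) : ℕ → C
  | 0 => ⊤_ C
  | n + 1 => G.obj (chainObj G n)

/-- The connecting morphisms `w₀ : W₁ ⟶ W₀` (unique) and `wₙ₊₁ = G wₙ`. -/
def chainMap (G : C ⥤ C) : ∀ n, chainObj G (n + 1) ⟶ chainObj G n
  | 0 => terminal.from _
  | n + 1 => G.map (chainMap G n)

/-- The terminal-coalgebra chain `W₀ ⟵ W₁ ⟵ W₂ ⟵ ⋯` of `G`. -/
def terminalCoalgebraChain (G : C ⥤ C) : ℕᵒᵖ ⥤ C :=
  Functor.ofOpSequence (chainMap G)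

end Iterative

namespace LambdaTree

/-! ## Finite trees with an additional constant `⊥`, and `α`-conversion -/

/-- Finite `λ`-trees over the variables `Var`, with an additional constant `⊥`. -/
inductive FinTree (Var : Type u) : Type u
  | bot : FinTree Var
  | var : Var → FinTree Var
  | app : FinTree Var → FinTree Var → FinTree Var
  | lam : Var → FinTree Var → FinTree Var

namespace FinTree

variable {Var : Type u}

/-- `Free x t`: the variable `x` occurs freely in `t`. -/
def Free (x : Var) : FinTree Var → Prop
  | bot => False
  | var y => x = y
  | app s t => Free x s ∨ Free x t
  | lam y t => x ≠ y ∧ Free x t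

open Classical in
/-- `subst z y t` is `t[z/y]`: every free occurrence of `y` is replaced by `z`. -/
def subst (z y : Var) : FinTree Var → FinTree Var
  | bot => bot
  | var x => var (if x = y then z else x)
  | app s t => app (subst z y s) (subst z y t)
  | lam x t => lam x (if x = y then t else subst z y t)

/-- `z` can be substituted for `y` in `t` without capture: no free occurrence of `y` lies in the
scope of a `λz`. -/
def Substitutable (z y : Var) : FinTree Var → Prop
  | bot => True
  | var _ => True
  | app s t => Substitutable z y s ∧ Substitutable z y t
  | lam x t => Free y (lam x t) → x ≠ z ∧ Substitutable z y t

/-- `α`-conversion of finite trees: the least congruence with `λy.t ∼ λz.t[z/y]`, where `z` is not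
free in `t` and is not captured by the substitution. -/
inductive Alpha : FinTree Var → FinTree Var → Prop
  | rename (y z : Var) (t : FinTree Var) : ¬ Free z t → Substitutable z y t →
      Alpha (lam y t) (lam z (subst z y t))
  | refl (t : FinTree Var) : Alpha t t
  | symm {s t : FinTree Var} : Alpha s t → Alpha t s
  | trans {r s t : FinTree Var} : Alpha r s → Alpha s t → Alpha r t
  | app {s s' t t' : FinTree Var} : Alpha s s' → Alpha t t' → Alpha (app s t) (app s' t')
  | lam (y : Var) {t t' : FinTree Var} : Alpha t t' → Alpha (lam y t) (lam y t')

lemma subst_of_not_free {y z : Var} {t : FinTree Var} (h : ¬ Free y t) : subst z y t = t := by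
  induction t with
  | bot => rfl
  | var x => simp only [Free] at h; simp [subst, Ne.symm h]
  | app s t ihs iht =>
    simp only [Free, not_or] at h
    simp [subst, ihs h.1, iht h.2]
  | lam x t ih =>
    by_cases hx : x = y
    · simp [subst, hx]
    · simp only [Free, not_and] at h
      simp [subst, hx, ih (h (Ne.symm hx))]

end FinTree

/-! ## Finite and infinite trees -/

/-- The possible labels of a node of a `λ`-tree: a variable `x`, or `@`, or `λ y`. -/
inductive Label (Var : Type u) : Type u
  | var : Var → Label Var
  | app : Label Var
  | lam : Var → Label Var

/-- The index type of the children of a node. -/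
def Label.Children {Var : Type u} : Label Var → Type
  | .var _ => Empty
  | .app => Bool
  | .lam _ => Unit

/-- The signature of `λ`-trees: leaves `x`, binary nodes `@` and unary nodes `λ y`. -/
def sig (Var : Type u) : PFunctor.{u, 0} := ⟨Label Var, Label.Children⟩

/-- All (finite and infinite) `λ`-trees. -/
abbrev Tree (Var : Type u) : Type u := PFunctor.M (sig Var)

namespace Tree

variable {Var : Type u}

/-- The tree consisting of the leaf `x`. -/
def var (x : Var) : Tree Var :=
  PFunctor.M.mk (F := sig Var) ⟨Label.var x, fun i : Empty => i.elim⟩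

/-- The tree with root `@` and the given left and right subtrees. -/
def app (s t : Tree Var) : Tree Var :=
  PFunctor.M.mk (F := sig Var) ⟨Label.app, fun i : Bool => bif i then t else s⟩

/-- The tree with root `λ y` and the given subtree. -/
def lam (y : Var) (t : Tree Var) : Tree Var :=
  PFunctor.M.mk (F := sig Var) ⟨Label.lam y, fun _ : Unit => t⟩

lemma cases_tree (t : Tree Var) :
    (∃ x, t = var x) ∨ (∃ s s', t = app s s') ∨ ∃ y s, t = lam y s := by
  induction t using PFunctor.M.casesOn' with
  | f a f =>
    cases a with
    | var x =>
      refine Or.inl ⟨x, ?_⟩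
      unfold var
      congr 2
      exact funext fun i => i.elim
    | app =>
      refine Or.inr (Or.inl ⟨f false, f true, ?_⟩)
      unfold app
      congr 2
      exact funext fun i => by cases i <;> rfl
    | lam y => exact Or.inr (Or.inr ⟨y, f (), rfl⟩)

lemma var_inj {x y : Var} (h : var x = var y) : x = y := by
  have := PFunctor.M.mk_inj h
  injection (Sigma.mk.inj this).1

lemma app_inj {s s' t t' : Tree Var} (h : app s t = app s' t') : s = s' ∧ t = t' := by
  have := eq_of_heq (Sigma.mk.inj (PFunctor.M.mk_inj h)).2
  exact ⟨congrFun this false, congrFun this true⟩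

lemma lam_inj {y y' : Var} {t t' : Tree Var} (h : lam y t = lam y' t') : y = y' ∧ t = t' := by
  obtain ⟨h1, h2⟩ := Sigma.mk.inj (PFunctor.M.mk_inj h)
  have h3 : y = y' := by injection h1
  subst h3
  exact ⟨rfl, congrFun (eq_of_heq h2) ()⟩

lemma var_ne_app {x : Var} {s t : Tree Var} (h : var x = app s t) : False := by
  have := (Sigma.mk.inj (PFunctor.M.mk_inj h)).1
  injection this

lemma var_ne_lam {x y : Var} {t : Tree Var} (h : var x = lam y t) : False := by
  have := (Sigma.mk.inj (PFunctor.M.mk_inj h)).1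
  injection this

lemma app_ne_lam {s t : Tree Var} {y : Var} {u : Tree Var} (h : app s t = lam y u) : False := by
  have := (Sigma.mk.inj (PFunctor.M.mk_inj h)).1
  injection this

/-- `Free x t`: the variable `x` occurs freely in `t`. -/
inductive Free (x : Var) : Tree Var → Prop
  | var : Free x (var x)
  | app_left {s : Tree Var} (t : Tree Var) : Free x s → Free x (app s t)
  | app_right (s : Tree Var) {t : Tree Var} : Free x t → Free x (app s t)
  | lam {y : Var} {t : Tree Var} : x ≠ y → Free x t → Free x (lam y t)

lemma free_var {x y : Var} (h : Free x (var y)) : x = y := by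
  generalize e : var y = t at h
  cases h with
  | var => exact (var_inj e).symm
  | app_left _ _ => exact (var_ne_app e).elim
  | app_right _ _ => exact (var_ne_app e).elim
  | lam _ _ => exact (var_ne_lam e).elim

lemma free_app {x : Var} {s t : Tree Var} (h : Free x (app s t)) : Free x s ∨ Free x t := by
  generalize e : app s t = u at h
  cases h with
  | var => exact (var_ne_app e.symm).elim
  | app_left _ h => exact Or.inl ((app_inj e).1 ▸ h)
  | app_right _ h => exact Or.inr ((app_inj e).2 ▸ h)
  | lam _ _ => exact (app_ne_lam e).elim

lemma free_lam {x y : Var} {t : Tree Var} (h : Free x (lam y t)) : x ≠ y ∧ Free x t := by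
  generalize e : lam y t = u at h
  cases h with
  | var => exact (var_ne_lam e.symm).elim
  | app_left _ _ => exact (app_ne_lam e.symm).elim
  | app_right _ _ => exact (app_ne_lam e.symm).elim
  | lam h1 h2 =>
    obtain ⟨rfl, rfl⟩ := lam_inj e
    exact ⟨h1, h2⟩

/-- The cutting of a tree at level `k`: all nodes at level `k` become leaves labelled `⊥`. -/
def cut : ℕ → Tree Var → FinTree Var
  | 0, _ => .bot
  | k + 1, t =>
    match PFunctor.M.dest t with
    | ⟨.var x, _⟩ => .var x
    | ⟨.app, f⟩ => .app (cut k (f false)) (cut k (f true))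
    | ⟨.lam y, f⟩ => .lam y (cut k (f ()))

@[simp] lemma cut_zero (t : Tree Var) : cut 0 t = .bot := rfl
@[simp] lemma cut_var (k : ℕ) (x : Var) : cut (k + 1) (var x) = .var x := rfl
@[simp] lemma cut_app (k : ℕ) (s t : Tree Var) :
    cut (k + 1) (app s t) = .app (cut k s) (cut k t) := rfl
@[simp] lemma cut_lam (k : ℕ) (y : Var) (t : Tree Var) :
    cut (k + 1) (lam y t) = .lam y (cut k t) := rfl

/-- `α`-conversion of infinite trees: all cuttings are `α`-equivalent. -/
def Alpha (s t : Tree Var) : Prop := ∀ k, FinTree.Alpha (cut k s) (cut k t)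

lemma free_of_free_cut {x : Var} (k : ℕ) : ∀ {t : Tree Var}, (cut k t).Free x → Free x t := by
  induction k with
  | zero => intro t h; exact h.elim
  | succ k ih =>
    intro t h
    obtain ⟨y, rfl⟩ | ⟨s, s', rfl⟩ | ⟨y, s, rfl⟩ := cases_tree t
    · obtain rfl : x = y := h
      exact .var
    · obtain h | h := h
      · exact .app_left _ (ih h)
      · exact .app_right _ (ih h)
    · exact .lam h.1 (ih h.2)

end Tree

/-! ## Relabelling -/

section Relabel

variable {Var : Type u} [Infinite Var]

/-- A chosen variable outside a given finite set. -/
def fresh (S : Finset Var) : Var := Classical.choose (Infinite.exists_notMem_finset S)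

lemma fresh_notMem (S : Finset Var) : fresh S ∉ S :=
  Classical.choose_spec (Infinite.exists_notMem_finset S)

open Classical in
/-- One layer of `Tree.relabel`. -/
def Tree.relabelStep :
    (Var → Var) × Finset Var × Tree Var → sig Var ((Var → Var) × Finset Var × Tree Var)
  | (ρ, S, t) =>
    match PFunctor.M.dest t with
    | ⟨.var x, _⟩ => ⟨.var (ρ x), fun i : Empty => i.elim⟩
    | ⟨.app, f⟩ => ⟨.app, fun i : Bool => (ρ, S, f i)⟩
    | ⟨.lam y, f⟩ => ⟨.lam (fresh S), fun _ : Unit =>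
        (Function.update ρ y (fresh S), insert (fresh S) S, f ())⟩

/-- `relabel ρ S t` replaces every free variable `x` of `t` by `ρ x` and every bound variable by
a fresh one, which does not lie in `S` and differs from the new names of the binders above it. See
`relabel_var`, `relabel_app` and `relabel_lam`. -/
def Tree.relabel (ρ : Var → Var) (S : Finset Var) (t : Tree Var) : Tree Var :=
  PFunctor.M.corec Tree.relabelStep (ρ, S, t)

namespace Tree

lemma relabel_var (ρ : Var → Var) (S : Finset Var) (x : Var) :
    relabel ρ S (var x) = var (ρ x) := by
  unfold relabel
  rw [PFunctor.M.corec_def]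
  exact congrArg (fun f => PFunctor.M.mk (F := sig Var) ⟨Label.var (ρ x), f⟩)
    (funext fun i => Empty.elim i)

lemma relabel_app (ρ : Var → Var) (S : Finset Var) (s t : Tree Var) :
    relabel ρ S (app s t) = app (relabel ρ S s) (relabel ρ S t) := by
  unfold relabel
  rw [PFunctor.M.corec_def]
  refine congrArg (fun f => PFunctor.M.mk (F := sig Var) ⟨Label.app, f⟩) (funext fun i => ?_)
  cases i using Bool.casesOn <;> rfl

open Classical in
lemma relabel_lam (ρ : Var → Var) (S : Finset Var) (y : Var) (t : Tree Var) :
    relabel ρ S (lam y t) =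
      lam (fresh S) (relabel (Function.update ρ y (fresh S)) (insert (fresh S) S) t) := by
  unfold relabel
  rw [PFunctor.M.corec_def]
  rfl

end Tree

/-! ### Relabelling respects `α`-conversion -/

namespace FinTree

open Classical in
/-- The counterpart of `Tree.relabel` for finite trees. -/
def relabel : (Var → Var) → Finset Var → FinTree Var → FinTree Var
  | _, _, bot => bot
  | ρ, _, var x => var (ρ x)
  | ρ, S, app s t => app (relabel ρ S s) (relabel ρ S t)
  | ρ, S, lam y t =>
    lam (fresh S) (relabel (Function.update ρ y (fresh S)) (insert (fresh S) S) t)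

lemma relabel_congr {t : FinTree Var} : ∀ {ρ σ : Var → Var} {S : Finset Var},
    (∀ x, Free x t → ρ x = σ x) → relabel ρ S t = relabel σ S t := by
  classical
  induction t with
  | bot => intros; rfl
  | var x => intro ρ σ S h; simp [relabel, h x rfl]
  | app s t ihs iht =>
    intro ρ σ S h
    simp [relabel, ihs fun x hx => h x (Or.inl hx), iht fun x hx => h x (Or.inr hx)]
  | lam y t ih =>
    intro ρ σ S h
    simp only [relabel]
    rw [ih]
    intro x hx
    by_cases hxy : x = y
    · simp [hxy]
    · simp [Function.update_of_ne hxy, h x ⟨hxy, hx⟩]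

lemma relabel_subst {y z : Var} {t : FinTree Var} : ∀ {ρ σ : Var → Var} {S : Finset Var},
    Substitutable z y t → (∀ x, Free x t → x ≠ y → ρ x = σ x) → ρ y = σ z →
    relabel σ S (subst z y t) = relabel ρ S t := by
  classical
  induction t with
  | bot => intros; rfl
  | var x =>
    intro ρ σ S _ h hy
    by_cases hx : x = y
    · simp [subst, relabel, hx, hy]
    · simp [subst, relabel, hx, h x rfl hx]
  | app s t ihs iht =>
    intro ρ σ S hs h hy
    simp [subst, relabel, ihs hs.1 (fun x hx => h x (Or.inl hx)) hy,
      iht hs.2 (fun x hx => h x (Or.inr hx)) hy]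
  | lam x t ih =>
    intro ρ σ S hs h hy
    by_cases hf : Free y (lam x t)
    · have hxy : x ≠ y := Ne.symm hf.1
      have hs' := hs hf
      simp only [subst, if_neg hxy, relabel]
      rw [ih hs'.2]
      · intro u hu huy
        by_cases hux : u = x
        · simp [hux]
        · simp [Function.update_of_ne hux, h u ⟨hux, hu⟩ huy]
      · rw [Function.update_of_ne hxy.symm, Function.update_of_ne hs'.1.symm, hy]
    · rw [subst_of_not_free hf]
      refine relabel_congr fun u hu => (h u hu ?_).symm
      rintro rfl
      exact hf hu

lemma Alpha.relabel_eq {s t : FinTree Var} (h : Alpha s t) :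
    ∀ (ρ : Var → Var) (S : Finset Var), relabel ρ S s = relabel ρ S t := by
  classical
  induction h with
  | rename y z t hz hs =>
    intro ρ S
    simp only [relabel]
    rw [relabel_subst (ρ := Function.update ρ y (fresh S)) hs]
    · intro x hx hxy
      have hxz : x ≠ z := by rintro rfl; exact hz hx
      simp [Function.update_of_ne hxy, Function.update_of_ne hxz]
    · simp
  | refl t => intros; rfl
  | symm _ ih => intro ρ S; exact (ih ρ S).symm
  | trans _ _ ih₁ ih₂ => intro ρ S; exact (ih₁ ρ S).trans (ih₂ ρ S)
  | app _ _ ih₁ ih₂ => intro ρ S; simp [relabel, ih₁ ρ S, ih₂ ρ S]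
  | lam y _ ih => intro ρ S; simp only [relabel]; rw [ih]

lemma relabel_relabel {t : FinTree Var} : ∀ {ρ σ : Var → Var} {S U : Finset Var},
    (∀ x, Free x t → ρ x ∈ S) →
    relabel σ U (relabel ρ S t) = relabel (σ ∘ ρ) U t := by
  classical
  induction t with
  | bot => intros; rfl
  | var x => intros; rfl
  | app s t ihs iht =>
    intro ρ σ S U h
    simp [relabel, ihs fun x hx => h x (Or.inl hx), iht fun x hx => h x (Or.inr hx)]
  | lam y t ih =>
    intro ρ σ S U h
    simp only [relabel]
    rw [ih]
    · congr 1
      refine relabel_congr fun x hx => ?_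
      by_cases hxy : x = y
      · simp [hxy]
      · have h1 : ρ x ≠ fresh S := fun e => fresh_notMem S (e ▸ h x ⟨hxy, hx⟩)
        simp [Function.update_of_ne hxy, Function.update_of_ne h1]
    · intro x hx
      by_cases hxy : x = y
      · simp [hxy]
      · simp [Function.update_of_ne hxy, h x ⟨hxy, hx⟩]

lemma free_relabel {t : FinTree Var} {x : Var} : ∀ {ρ : Var → Var} {S : Finset Var},
    Free x (relabel ρ S t) → ∃ y, Free y t ∧ ρ y = x := by
  classical
  induction t with
  | bot => intro ρ S h; exact h.elim
  | var y => intro ρ S h; exact ⟨y, rfl, Eq.symm h⟩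
  | app s t ihs iht =>
    rintro ρ S (h | h)
    · obtain ⟨y, hy, e⟩ := ihs h
      exact ⟨y, Or.inl hy, e⟩
    · obtain ⟨y, hy, e⟩ := iht h
      exact ⟨y, Or.inr hy, e⟩
  | lam z t ih =>
    rintro ρ S ⟨hne, h⟩
    obtain ⟨y, hy, e⟩ := ih h
    by_cases hyz : y = z
    · subst hyz
      simp only [Function.update_self] at e
      exact absurd e.symm hne
    · rw [Function.update_of_ne hyz] at e
      exact ⟨y, ⟨hyz, hy⟩, e⟩

lemma substitutable_relabel {t : FinTree Var} {y z : Var} : ∀ {ρ : Var → Var} {S : Finset Var},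
    z ∈ S → Substitutable z y (relabel ρ S t) := by
  classical
  induction t with
  | bot => intros; trivial
  | var x => intros; trivial
  | app s t ihs iht => intro ρ S h; exact ⟨ihs h, iht h⟩
  | lam x t ih =>
    intro ρ S h _
    exact ⟨fun e => fresh_notMem S (e ▸ h), ih (Finset.mem_insert_of_mem h)⟩

open Classical in
lemma subst_relabel {t : FinTree Var} {y z : Var} : ∀ {ρ σ : Var → Var} {S : Finset Var},
    y ∈ S → (∀ x, Free x t → σ x = if ρ x = y then z else ρ x) →
    subst z y (relabel ρ S t) = relabel σ S t := by
  classical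
  induction t with
  | bot => intros; rfl
  | var x => intro ρ σ S _ h; simp [subst, relabel, h x rfl]
  | app s t ihs iht =>
    intro ρ σ S hy h
    simp [subst, relabel, ihs hy (fun x hx => h x (Or.inl hx)),
      iht hy (fun x hx => h x (Or.inr hx))]
  | lam x t ih =>
    intro ρ σ S hy h
    have hne : fresh S ≠ y := fun e => fresh_notMem S (e ▸ hy)
    simp only [subst, relabel, if_neg hne]
    rw [ih (σ := Function.update σ x (fresh S)) (Finset.mem_insert_of_mem hy)]
    intro u hu
    by_cases hux : u = x
    · simp [hux, hne]
    · simp [Function.update_of_ne hux, h u ⟨hux, hu⟩]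

lemma alpha_relabel_relabel {t : FinTree Var} : ∀ {ρ : Var → Var} {S U : Finset Var},
    (∀ x, Free x t → ρ x ∈ S ∧ ρ x ∈ U) → Alpha (relabel ρ S t) (relabel ρ U t) := by
  classical
  induction t with
  | bot => intros; exact .refl _
  | var x => intros; exact .refl _
  | app s t ihs iht =>
    intro ρ S U h
    exact .app (ihs fun x hx => h x (Or.inl hx)) (iht fun x hx => h x (Or.inr hx))
  | lam y t ih =>
    intro ρ S U h
    simp only [relabel]
    have haS := fresh_notMem S
    have hbU := fresh_notMem U
    generalize fresh S = a at haS ⊢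
    generalize fresh U = b at hbU ⊢
    let T : Finset Var := insert a (insert b (S ∪ U))
    have h1 : Alpha (relabel (Function.update ρ y a) (insert a S) t)
        (relabel (Function.update ρ y a) T t) := by
      refine ih fun x hx => ?_
      by_cases hxy : x = y
      · simp [hxy, T]
      · simp [Function.update_of_ne hxy, T, (h x ⟨hxy, hx⟩).1]
    have h2 : Alpha (relabel (Function.update ρ y b) T t)
        (relabel (Function.update ρ y b) (insert b U) t) := by
      refine ih fun x hx => ?_
      by_cases hxy : x = y
      · simp [hxy, T]
      · simp [Function.update_of_ne hxy, T, (h x ⟨hxy, hx⟩).2]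
    convert (Alpha.lam a h1).trans (Alpha.trans ?_ (Alpha.lam b h2))
    have h3 : subst b a (relabel (Function.update ρ y a) T t) =
        relabel (Function.update ρ y b) T t := by
      refine subst_relabel (by simp [T]) (fun x hx => ?_)
      by_cases hxy : x = y
      · simp [hxy]
      · have : ρ x ≠ a := fun e => haS (e ▸ (h x ⟨hxy, hx⟩).1)
        simp [Function.update_of_ne hxy, this]
    by_cases hab : a = b
    · subst hab; exact .refl _
    rw [← h3]
    refine .rename _ _ _ (fun hf => ?_) (substitutable_relabel (by simp [T]))
    obtain ⟨x, hx, e⟩ := free_relabel hf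
    by_cases hxy : x = y
    · subst hxy; simp only [Function.update_self] at e; exact hab e
    · rw [Function.update_of_ne hxy] at e
      exact hbU (e ▸ (h x ⟨hxy, hx⟩).2)

lemma alpha_relabel_id {t : FinTree Var} : ∀ {S : Finset Var},
    (∀ x, Free x t → x ∈ S) → Alpha (relabel id S t) t := by
  classical
  induction t with
  | bot => intros; exact .refl _
  | var x => intros; exact .refl _
  | app s t ihs iht =>
    intro S h
    exact .app (ihs fun x hx => h x (Or.inl hx)) (iht fun x hx => h x (Or.inr hx))
  | lam y t ih =>
    intro S h
    simp only [relabel]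
    have haS := fresh_notMem S
    generalize fresh S = a at haS ⊢
    let T : Finset Var := insert a (insert y S)
    have hT : ∀ x, Free x t → x ∈ T := fun x hx => by
      by_cases hxy : x = y
      · simp [hxy, T]
      · simp [T, h x ⟨hxy, hx⟩]
    have h1 : Alpha (lam y (relabel id T t)) (lam y t) := .lam y (ih hT)
    have h2 : Alpha (relabel (Function.update id y a) (insert a S) t)
        (relabel (Function.update id y a) T t) := by
      refine alpha_relabel_relabel fun x hx => ?_
      by_cases hxy : x = y
      · simp [hxy, T]
      · simp [Function.update_of_ne hxy, T, h x ⟨hxy, hx⟩]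
    have h3 : subst a y (relabel id T t) = relabel (Function.update id y a) T t := by
      refine subst_relabel (by simp [T]) (fun x hx => ?_)
      by_cases hxy : x = y
      · simp [hxy]
      · simp [hxy]
    convert ((Alpha.lam a h2).trans ?_).trans h1
    by_cases hya : y = a
    · rw [← h3, hya]
      have : subst a a (relabel id T t) = relabel id T t := by
        refine subst_relabel (by simp [T]) (fun x hx => ?_)
        by_cases hxa : x = a <;> simp [hxa]
      rw [this]
      exact .refl _
    rw [← h3]
    refine .symm (.rename _ _ _ (fun hf => ?_) (substitutable_relabel (by simp [T])))
    obtain ⟨x, hx, e⟩ := free_relabel hf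
    have e' : x = a := e
    subst e'
    exact haS (h x ⟨fun e => hya e.symm, hx⟩)

end FinTree

namespace Tree

lemma cut_relabel (k : ℕ) : ∀ (ρ : Var → Var) (S : Finset Var) (t : Tree Var),
    cut k (relabel ρ S t) = FinTree.relabel ρ S (cut k t) := by
  induction k with
  | zero => intros; rfl
  | succ k ih =>
    intro ρ S t
    obtain ⟨x, rfl⟩ | ⟨s, s', rfl⟩ | ⟨y, s, rfl⟩ := cases_tree t
    · simp [relabel_var, FinTree.relabel]
    · simp [relabel_app, FinTree.relabel, ih]
    · simp [relabel_lam, FinTree.relabel, ih]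

lemma free_relabel {x : Var} {u : Tree Var} (h : Free x u) :
    ∀ (t : Tree Var) (ρ : Var → Var) (S : Finset Var), u = relabel ρ S t →
      ∃ y, Free y t ∧ ρ y = x := by
  classical
  induction h with
  | var =>
    intro t ρ S e
    obtain ⟨y, rfl⟩ | ⟨s, s', rfl⟩ | ⟨y, s, rfl⟩ := cases_tree t
    · rw [relabel_var] at e
      exact ⟨y, .var, (var_inj e).symm⟩
    · rw [relabel_app] at e
      exact (var_ne_app e).elim
    · rw [relabel_lam] at e
      exact (var_ne_lam e).elim
  | app_left u' h ih =>
    intro t ρ S e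
    obtain ⟨y, rfl⟩ | ⟨s, s', rfl⟩ | ⟨y, s, rfl⟩ := cases_tree t
    · rw [relabel_var] at e
      exact (var_ne_app e.symm).elim
    · rw [relabel_app] at e
      obtain ⟨y, hy, e'⟩ := ih s ρ S (app_inj e).1
      exact ⟨y, .app_left _ hy, e'⟩
    · rw [relabel_lam] at e
      exact (app_ne_lam e).elim
  | app_right u' h ih =>
    intro t ρ S e
    obtain ⟨y, rfl⟩ | ⟨s, s', rfl⟩ | ⟨y, s, rfl⟩ := cases_tree t
    · rw [relabel_var] at e
      exact (var_ne_app e.symm).elim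
    · rw [relabel_app] at e
      obtain ⟨y, hy, e'⟩ := ih s' ρ S (app_inj e).2
      exact ⟨y, .app_right _ hy, e'⟩
    · rw [relabel_lam] at e
      exact (app_ne_lam e).elim
  | @lam z u' hne h ih =>
    intro t ρ S e
    obtain ⟨y, rfl⟩ | ⟨s, s', rfl⟩ | ⟨y, s, rfl⟩ := cases_tree t
    · rw [relabel_var] at e
      exact (var_ne_lam e.symm).elim
    · rw [relabel_app] at e
      exact (app_ne_lam e.symm).elim
    · rw [relabel_lam] at e
      obtain ⟨rfl, e2⟩ := lam_inj e
      obtain ⟨v, hv, e'⟩ := ih s _ _ e2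
      by_cases hvy : v = y
      · subst hvy
        simp only [Function.update_self] at e'
        exact absurd e'.symm hne
      · rw [Function.update_of_ne hvy] at e'
        exact ⟨v, .lam hvy hv, e'⟩

end Tree
end Relabel

/-! ## Contexts and presheaves -/

/-- Contexts: finite sets of variables, as a full subcategory of the category of sets. -/
abbrev Ctx (Var : Type u) : Type u :=
  InducedCategory (Type u) fun Γ : Finset Var => {x : Var // x ∈ Γ}

/-- The finite set of variables underlying a context. -/
def Ctx.vars {Var : Type u} (Γ : Ctx Var) : Finset Var := Γ

/-- Covariant presheaves on the category of contexts ("sets in context"). -/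
abbrev Presheaf (Var : Type u) := Ctx Var ⥤ Type u

/-- The presheaf of variables `V(Γ) = Γ`. -/
def varPresheaf (Var : Type u) : Presheaf Var := inducedFunctor _

section Contexts

variable {Var : Type u}

open Classical in
/-- A map of contexts, extended to all variables by the identity. -/
def Ctx.extend {Γ Δ : Ctx Var} (γ : Γ ⟶ Δ) (x : Var) : Var :=
  if h : x ∈ Γ.vars then (γ.hom ⟨x, h⟩).1 else x

lemma Ctx.extend_of_mem {Γ Δ : Ctx Var} (γ : Γ ⟶ Δ) {x : Var} (h : x ∈ Γ.vars) :
    Ctx.extend γ x = (γ.hom ⟨x, h⟩).1 := dif_pos h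

lemma Ctx.extend_mem {Γ Δ : Ctx Var} (γ : Γ ⟶ Δ) {x : Var} (h : x ∈ Γ.vars) :
    Ctx.extend γ x ∈ Δ.vars := by
  rw [Ctx.extend_of_mem γ h]
  exact (γ.hom ⟨x, h⟩).2

variable [Infinite Var]

open Classical in
/-- The functor `Γ ↦ Γ + 1`: a context is extended by a chosen variable outside of it, and a map
`γ : Γ ⟶ Δ` by the assignment of the new variable of `Δ + 1` to the new variable of `Γ + 1`. -/
def Ctx.addOne : Ctx Var ⥤ Ctx Var where
  obj Γ := (insert (fresh Γ.vars) Γ.vars : Finset Var)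
  map {Γ Δ} γ := InducedCategory.homMk <| ↾ fun x =>
    if h : x.1 ∈ Γ.vars then
      ⟨(γ.hom ⟨x.1, h⟩).1, Finset.mem_insert_of_mem (γ.hom ⟨x.1, h⟩).2⟩
    else ⟨fresh Δ.vars, Finset.mem_insert_self _ _⟩
  map_id Γ := by
    ext ⟨x, hx⟩
    by_cases h : x ∈ Γ.vars
    · simp [h]
    · have : x = fresh Γ.vars := (Finset.mem_insert.1 hx).resolve_right h
      simp [this, fresh_notMem]
  map_comp {Γ Δ Θ} γ γ' := by
    ext ⟨x, hx⟩
    by_cases h : x ∈ Γ.vars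
    · have : (γ.hom ⟨x, h⟩).1 ∈ Δ.vars := (γ.hom ⟨x, h⟩).2
      simp [h, this]
    · simp [h, fresh_notMem]

/-- The endofunctor `δ`, given by `(δX)(Γ) = X(Γ + 1)`. -/
def delta : Presheaf Var ⥤ Presheaf Var :=
  (Functor.whiskeringLeft (Ctx Var) (Ctx Var) (Type u)).obj Ctx.addOne

/-- The endofunctor `H_λ X = X × X + δX`. -/
def Hlam : Presheaf Var ⥤ Presheaf Var where
  obj X :=
    { obj := fun Γ => (X.obj Γ × X.obj Γ) ⊕ (delta.obj X).obj Γ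
      map := fun γ => ↾ Sum.map (Prod.map (X.map γ) (X.map γ)) ((delta.obj X).map γ)
      map_id := fun Γ => by
        ext (⟨x, y⟩ | x) <;> simp
      map_comp := fun γ γ' => by
        ext (⟨x, y⟩ | x) <;> simp }
  map f :=
    { app := fun Γ => ↾ Sum.map (Prod.map (f.app Γ) (f.app Γ)) ((delta.map f).app Γ)
      naturality := fun Γ Δ γ => by
        ext (⟨x, y⟩ | x)
        · simp
        · exact congrArg Sum.inr (NatTrans.naturality_apply (delta.map f) γ x) }
  map_id X := by
    ext Γ (⟨x, y⟩ | x) <;> simp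
  map_comp f g := by
    ext Γ (⟨x, y⟩ | x) <;> simp

end Contexts

/-! ## The presheaf `T_λ` of all finite and infinite `λ`-terms -/

section Terms

variable {Var : Type u}

/-- `T'_λ(Γ)`: the trees with free variables in the context `Γ`. -/
def TreeIn (Γ : Ctx Var) : Type u := {t : Tree Var // ∀ x, Tree.Free x t → x ∈ Γ.vars}

/-- `α`-conversion on `T'_λ(Γ)`. -/
instance TreeIn.setoid (Γ : Ctx Var) : Setoid (TreeIn Γ) where
  r s t := Tree.Alpha s.1 t.1
  iseqv :=
    { refl := fun _ _ => .refl _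
      symm := fun h k => (h k).symm
      trans := fun h h' k => (h k).trans (h' k) }

/-- `T_λ(Γ)`: the trees with free variables in `Γ`, modulo `α`-conversion. -/
def Term (Γ : Ctx Var) : Type u := Quotient (TreeIn.setoid Γ)

/-- The variable `x` of `Γ` as a tree in context `Γ`. -/
def TreeIn.var {Γ : Ctx Var} (x : {x : Var // x ∈ Γ.vars}) : TreeIn Γ :=
  ⟨Tree.var x.1, fun _ hy => Tree.free_var hy ▸ x.2⟩

/-- The application of two trees in context `Γ`. -/
def TreeIn.app {Γ : Ctx Var} (s t : TreeIn Γ) : TreeIn Γ :=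
  ⟨Tree.app s.1 t.1, fun y hy => (Tree.free_app hy).elim (s.2 y) (t.2 y)⟩

lemma TreeIn.app_alpha {Γ : Ctx Var} ⦃s s' : TreeIn Γ⦄ (h : s ≈ s') ⦃t t' : TreeIn Γ⦄
    (h' : t ≈ t') : TreeIn.app s t ≈ TreeIn.app s' t' := by
  rintro (_ | k)
  · exact .refl _
  · exact .app (h k) (h' k)

variable [Infinite Var]

open Classical in
/-- The abstraction `λx.t` in context `Γ`, for a tree `t` in context `Γ + {x}`. -/
def TreeIn.lam {Γ : Ctx Var} (t : TreeIn (Ctx.addOne.obj Γ)) : TreeIn Γ :=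
  ⟨Tree.lam (fresh Γ.vars) t.1, fun y hy =>
    (Finset.mem_insert.1 (t.2 y (Tree.free_lam hy).2)).resolve_left (Tree.free_lam hy).1⟩

lemma TreeIn.lam_alpha {Γ : Ctx Var} ⦃t t' : TreeIn (Ctx.addOne.obj Γ)⦄ (h : t ≈ t') :
    TreeIn.lam t ≈ TreeIn.lam t' := by
  rintro (_ | k)
  · exact .refl _
  · exact .lam _ (h k)

/-- Relabelling of the free variables of a tree along a map `γ : Γ ⟶ Δ` of contexts, where all
bound variables are relabelled so that they do not lie in `Δ`. -/
def TreeIn.map {Γ Δ : Ctx Var} (γ : Γ ⟶ Δ) (t : TreeIn Γ) : TreeIn Δ :=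
  ⟨Tree.relabel (Ctx.extend γ) Δ.vars t.1, fun x hx => by
    obtain ⟨y, hy, rfl⟩ := Tree.free_relabel hx _ _ _ rfl
    exact Ctx.extend_mem γ (t.2 y hy)⟩

lemma TreeIn.lam_map {Γ Δ : Ctx Var} (γ : Γ ⟶ Δ) (t : TreeIn (Ctx.addOne.obj Γ)) :
    TreeIn.lam (TreeIn.map (Ctx.addOne.map γ) t) ≈ TreeIn.map γ (TreeIn.lam t) := by
  classical
  rintro (_ | k)
  · exact .refl _
  simp only [TreeIn.map, TreeIn.lam, Tree.relabel_lam, Tree.cut_lam, Tree.cut_relabel]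
  have hS : Ctx.vars (Ctx.addOne.obj Δ) = insert (fresh Δ.vars) Δ.vars := by
    simp only [Ctx.addOne, Ctx.vars]
  rw [hS, FinTree.relabel_congr (σ := Function.update (Ctx.extend γ) (fresh Γ.vars) (fresh Δ.vars))]
  · exact .refl _
  intro x hx
  have hx' := t.2 x (Tree.free_of_free_cut k hx)
  rw [Ctx.extend_of_mem _ hx']
  by_cases h : x ∈ Γ.vars
  · have h1 : x ≠ fresh Γ.vars := fun e => fresh_notMem Γ.vars (e ▸ h)
    rw [Function.update_of_ne h1, Ctx.extend_of_mem γ h]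
    exact congrArg Subtype.val (dif_pos h)
  · have h1 : x = fresh Γ.vars := by
      simpa [Ctx.addOne, Ctx.vars, h] using (Finset.mem_insert.1 hx').resolve_right h
    subst h1
    rw [Function.update_self]
    exact congrArg Subtype.val (dif_neg h)

/-- The presheaf `T_λ` of all finite and infinite `λ`-terms. -/
def Tlam (Var : Type u) [Infinite Var] : Presheaf Var where
  obj Γ := Term Γ
  map {Γ Δ} γ := ↾ Quotient.map (TreeIn.map γ) (by
    intro s t h k
    simp only [TreeIn.map, Tree.cut_relabel]
    rw [(h k).relabel_eq]
    exact .refl _)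
  map_id Γ := by
    ext t
    induction t using Quotient.inductionOn with
    | h t =>
    refine Quotient.sound fun k => ?_
    have h : ∀ x, (t.1.cut k).Free x → x ∈ Γ.vars := fun x hx => t.2 x (Tree.free_of_free_cut k hx)
    simp only [TreeIn.map, Tree.cut_relabel]
    rw [FinTree.relabel_congr (σ := id) fun x hx => Ctx.extend_of_mem (𝟙 Γ) (h x hx)]
    exact FinTree.alpha_relabel_id h
  map_comp {Γ Δ Θ} γ γ' := by
    ext t
    induction t using Quotient.inductionOn with
    | h t =>
    refine Quotient.sound fun k => ?_
    have h : ∀ x, (t.1.cut k).Free x → x ∈ Γ.vars := fun x hx => t.2 x (Tree.free_of_free_cut k hx)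
    simp only [TreeIn.map, Tree.cut_relabel]
    rw [FinTree.relabel_relabel fun x hx => Ctx.extend_mem γ (h x hx)]
    rw [FinTree.relabel_congr (σ := Ctx.extend γ' ∘ Ctx.extend γ)]
    · exact .refl _
    · intro x hx
      rw [Ctx.extend_of_mem _ (h x hx), Function.comp_apply,
        Ctx.extend_of_mem _ (Ctx.extend_mem γ (h x hx))]
      simp [Ctx.extend_of_mem γ (h x hx)]

/-- The inclusion of variables `i : V ⟶ T_λ`. -/
def varTlam (Var : Type u) [Infinite Var] : varPresheaf Var ⟶ Tlam Var where
  app Γ := ↾ fun x => (⟦TreeIn.var x⟧ : Term Γ)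
  naturality Γ Δ γ := by
    ext x
    refine Quotient.sound fun k => ?_
    simp only [TreeIn.map, TreeIn.var, Tree.relabel_var]
    rw [Ctx.extend_of_mem γ x.2]
    exact .refl _

/-- The algebra `τ : H_λ T_λ ⟶ T_λ` given by application and abstraction. -/
def TlamAlgebra (Var : Type u) [Infinite Var] : Endofunctor.Algebra (Hlam (Var := Var)) where
  a := Tlam Var
  str :=
    { app := fun Γ => ↾ Sum.elim
        (fun p : Term Γ × Term Γ => Quotient.map₂ TreeIn.app TreeIn.app_alpha p.1 p.2)
        (fun t : Term (Ctx.addOne.obj Γ) => (Quotient.map TreeIn.lam TreeIn.lam_alpha t : Term Γ))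
      naturality := fun Γ Δ γ => by
        ext (⟨s, t⟩ | t)
        · induction s using Quotient.inductionOn with
          | h s =>
          induction t using Quotient.inductionOn with
          | h t =>
          refine Quotient.sound fun k => ?_
          simp only [TreeIn.map, TreeIn.app, Tree.relabel_app]
          exact .refl _
        · induction t using Quotient.inductionOn with
          | h t => exact Quotient.sound (TreeIn.lam_map γ t) }

end Terms

end LambdaTree

end

/-! Write `G = H_λ(-) + V`. Everything follows from one fact: with the structure `[τ, i]⁻¹`, the
cone over the chain of `G` that this coalgebra induces on `T_λ` is a limit cone.

From the limit to terminality: a coalgebra `c` on `X` induces its own cone over the chain. A map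
from `X` to `T_λ` is a coalgebra homomorphism exactly when it carries the limit projections to that
cone, so there is exactly one (`existsUnique_hom_of_isLimit_coalgebraCone`). Since the structure on
`T_λ` is already invertible, `G` need not preserve the limit.

From terminality to freeness, for any `H` and `Y`: an equation `e : X ⟶ HX + A` becomes a coalgebra
on `X + A` whose homomorphisms `[s, id]` correspond to the solutions `s`. Homomorphisms from `A` to
a completely iterative `B` extending `f` are the solutions in `B` of the equation `(id + f) ∘ φ`,
where `φ` is the coalgebra structure of `A`.

The limit itself is computed in each context. For finite trees with free variables in `S`, `relabel
id S` is a normal form for `α`-conversion (`FinTree.alpha_iff_relabel_eq`), so application and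
abstraction can be cancelled up to `α`. Hence `[τ, i]` is bijective and, by induction, the kernel of
the `n`-th projection is `α`-equivalence of cuttings (`cutting_eq_iff`). A compatible family is
represented by trees whose cuttings agree up to `α`; normalizing makes them agree literally, and
they glue to one infinite tree (`Tree.exists_cut_eq`). It is unique because `α`-conversion of
infinite trees is defined by cuttings. -/

/-! ### Terminal coalgebras of `H(-) + Y` as free completely iterative algebras. -/

section Iterative

variable {C : Type w} [Category.{v} C] [HasBinaryCoproducts C] {H : C ⥤ C} {Y : C}

/-- A terminal coalgebra for `H(-) + Y` is a completely iterative algebra for `H`. -/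
theorem isCIA_of_existsUnique_coalgebra_hom (A : Endofunctor.Algebra H) (η : Y ⟶ A.a)
    (φ : A.a ≅ H.obj A.a ⨿ Y) (hφ : φ.inv = coprod.desc A.str η)
    (hT : ∀ (K : C) (k : K ⟶ H.obj K ⨿ Y),
      ∃! f : K ⟶ A.a, k ≫ coprod.map (H.map f) (𝟙 Y) = f ≫ φ.hom) : IsCIA A := by
  intro X e
  let inA : H.obj A.a ⨿ Y ⟶ H.obj (X ⨿ A.a) ⨿ Y := coprod.map (H.map coprod.inr) (𝟙 Y)
  -- The equation as a coalgebra on `X + A`: unknowns unfold by `e`, and parameters in `A` unfold by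
  -- `φ`.
  let k : X ⨿ A.a ⟶ H.obj (X ⨿ A.a) ⨿ Y := coprod.desc
    (e ≫ coprod.desc (H.map coprod.inl ≫ coprod.inl) (φ.hom ≫ inA)) (φ.hom ≫ inA)
  have hinl : coprod.inl ≫ k =
      e ≫ coprod.desc (H.map coprod.inl ≫ coprod.inl) (φ.hom ≫ inA) := coprod.inl_desc _ _
  have hinr : coprod.inr ≫ k = φ.hom ≫ inA := coprod.inr_desc _ _
  have hstr : A.str ≫ φ.hom = coprod.inl := by
    rw [← Iso.eq_comp_inv, hφ, coprod.inl_desc]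
  -- On the summand `A`, `[s, id]` is always compatible with the structures (`hA`); on `X`,
  -- compatibility is the equation for `s` up to the isomorphism `φ` (`hX`).
  have key : ∀ s : X ⟶ A.a,
      s = e ≫ coprod.map (H.map s) (𝟙 A.a) ≫ coprod.desc A.str (𝟙 A.a) ↔
        k ≫ coprod.map (H.map (coprod.desc s (𝟙 A.a))) (𝟙 Y) =
          coprod.desc s (𝟙 A.a) ≫ φ.hom := by
    intro s
    have hA : inA ≫ coprod.map (H.map (coprod.desc s (𝟙 A.a))) (𝟙 Y) = 𝟙 _ := by
      simp only [inA, coprod.map_map, ← H.map_comp, coprod.inr_desc, H.map_id, Category.comp_id,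
        coprod.map_id_id]
    have hX : coprod.inl ≫ k ≫ coprod.map (H.map (coprod.desc s (𝟙 A.a))) (𝟙 Y) =
        (e ≫ coprod.map (H.map s) (𝟙 A.a) ≫ coprod.desc A.str (𝟙 A.a)) ≫ φ.hom := by
      rw [← Category.assoc, hinl, Category.assoc, Category.assoc, Category.assoc]
      congr 1
      apply coprod.hom_ext
      · simp only [coprod.inl_desc_assoc, Category.assoc, coprod.inl_map, coprod.inl_map_assoc,
          hstr, ← H.map_comp_assoc, coprod.inl_desc]
      · simp only [coprod.inr_desc_assoc, Category.assoc, hA, Category.comp_id,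
          coprod.inr_map_assoc, Category.id_comp]
    constructor
    · intro hs
      apply coprod.hom_ext
      · rw [hX, ← hs, coprod.inl_desc_assoc]
      · rw [← Category.assoc, hinr, Category.assoc, hA, coprod.inr_desc_assoc, Category.comp_id,
          Category.id_comp]
    · intro h
      rw [h, coprod.inl_desc_assoc] at hX
      exact (cancel_mono φ.hom).1 hX
  obtain ⟨t, ht, htu⟩ := hT _ k
  -- The restriction of `t` to `A` is an endomorphism of the terminal coalgebra, hence the identity,
  -- so `t` has the form `[s, id]`.
  have htA : coprod.inr ≫ t = 𝟙 A.a := by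
    refine (hT A.a φ.hom).unique ?_ (by simp)
    rw [Category.assoc, ← ht, ← Category.assoc coprod.inr, hinr, Category.assoc]
    simp only [inA, coprod.map_map, ← H.map_comp, Category.comp_id]
  have ht' : t = coprod.desc (coprod.inl ≫ t) (𝟙 A.a) := by
    apply coprod.hom_ext
    · rw [coprod.inl_desc]
    · rw [coprod.inr_desc, htA]
  refine ⟨coprod.inl ≫ t, (key _).2 ?_, fun s hs => ?_⟩
  · rw [← ht']
    exact ht
  · rw [← htu _ ((key s).1 hs), coprod.inl_desc]

/-- A terminal coalgebra for `H(-) + Y` is a free completely iterative algebra on `Y`. -/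
theorem isFreeCIA_of_existsUnique_coalgebra_hom (A : Endofunctor.Algebra H) (η : Y ⟶ A.a)
    (φ : A.a ≅ H.obj A.a ⨿ Y) (hφ : φ.inv = coprod.desc A.str η)
    (hT : ∀ (K : C) (k : K ⟶ H.obj K ⨿ Y),
      ∃! f : K ⟶ A.a, k ≫ coprod.map (H.map f) (𝟙 Y) = f ≫ φ.hom) :
    IsFreeCIA A η where
  isCIA := isCIA_of_existsUnique_coalgebra_hom A η φ hφ hT
  existsUnique_hom B hB f := by
    -- Precomposing with `φ⁻¹ = [A.str, η]` splits the solution equation into the homomorphism law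
    -- and the condition on `η`.
    have key : ∀ h : A.a ⟶ B.a,
        h = (φ.hom ≫ coprod.map (𝟙 _) f) ≫ coprod.map (H.map h) (𝟙 B.a) ≫
            coprod.desc B.str (𝟙 B.a) ↔
          H.map h ≫ B.str = A.str ≫ h ∧ η ≫ h = f := by
      intro h
      have hr : (φ.hom ≫ coprod.map (𝟙 _) f) ≫ coprod.map (H.map h) (𝟙 B.a) ≫
          coprod.desc B.str (𝟙 B.a) = φ.hom ≫ coprod.desc (H.map h ≫ B.str) f := by
        simp only [Category.assoc, coprod.map_desc, Category.id_comp, Category.comp_id]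
      rw [hr, ← Iso.inv_comp_eq, hφ, coprod.desc_comp]
      constructor
      · intro e
        have h1 := congrArg (fun g => coprod.inl ≫ g) e
        have h2 := congrArg (fun g => coprod.inr ≫ g) e
        simp only [coprod.inl_desc, coprod.inr_desc] at h1 h2
        exact ⟨h1.symm, h2⟩
      · rintro ⟨h1, h2⟩
        rw [h1, h2]
    obtain ⟨h, hh, hu⟩ := hB A.a (φ.hom ≫ coprod.map (𝟙 _) f)
    refine ⟨⟨h, ((key h).1 hh).1⟩, ((key h).1 hh).2, fun g hg => ?_⟩
    ext
    exact hu g.f ((key g.f).2 ⟨g.h, hg⟩)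

end Iterative

/-! ### From a limit of the terminal-coalgebra chain to a terminal coalgebra. -/

section Chain

variable {C : Type w} [Category.{v} C] [HasTerminal C] (G : C ⥤ C)

/-- The canonical morphisms from a coalgebra to the objects of the terminal-coalgebra chain. -/
noncomputable def coalgebraToChain {X : C} (c : X ⟶ G.obj X) : ∀ n, X ⟶ chainObj G n
  | 0 => terminal.from _
  | n + 1 => c ≫ G.map (coalgebraToChain c n)

lemma coalgebraToChain_chainMap {X : C} (c : X ⟶ G.obj X) (n : ℕ) :
    coalgebraToChain G c (n + 1) ≫ chainMap G n = coalgebraToChain G c n := by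
  induction n with
  | zero => exact terminal.hom_ext _ _
  | succ n ih =>
    change (c ≫ G.map (coalgebraToChain G c (n + 1))) ≫ G.map (chainMap G n) =
      c ≫ G.map (coalgebraToChain G c n)
    rw [Category.assoc, ← G.map_comp, ih]

/-- The cone over the terminal-coalgebra chain induced by a coalgebra. -/
noncomputable def coalgebraCone {X : C} (c : X ⟶ G.obj X) :
    (Functor.const ℕᵒᵖ).obj X ⟶ terminalCoalgebraChain G :=
  NatTrans.ofOpSequence (F := (Functor.const ℕᵒᵖ).obj X) (G := terminalCoalgebraChain G)
    (fun n => coalgebraToChain G c n) fun n => by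
      have h : (terminalCoalgebraChain G).map (homOfLE (Nat.le_add_right n 1)).op =
          chainMap G n := Functor.ofOpSequence_map_homOfLE_succ _ n
      rw [h]
      exact (Category.id_comp _).trans (coalgebraToChain_chainMap G c n).symm

/-- If the cone induced by a coalgebra with invertible structure is a limit, then the coalgebra is
terminal. -/
theorem existsUnique_hom_of_isLimit_coalgebraCone {T : C} (φ : T ≅ G.obj T)
    (hL : IsLimit (Cone.mk T (coalgebraCone G φ.hom))) {X : C} (c : X ⟶ G.obj X) :
    ∃! f : X ⟶ T, c ≫ G.map f = f ≫ φ.hom := by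
  have hom_ext : ∀ {f g : X ⟶ T}, (∀ n, f ≫ coalgebraToChain G φ.hom n =
      g ≫ coalgebraToChain G φ.hom n) → f = g :=
    fun h => hL.hom_ext fun j => h j.unop
  let l : X ⟶ T := hL.lift (Cone.mk X (coalgebraCone G c))
  have fac : ∀ n : ℕ, l ≫ coalgebraToChain G φ.hom n = coalgebraToChain G c n :=
    fun n => hL.fac (Cone.mk _ (coalgebraCone G c)) (op n)
  refine ⟨l, ?_, fun m hm => ?_⟩
  · dsimp only
    -- Moving `φ` across makes both sides maps into `T`, where the limit projections separate maps;
    -- nothing has to be compared in `G T`.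
    rw [← Iso.comp_inv_eq]
    refine hom_ext fun n => ?_
    rw [fac]
    cases n with
    | zero => exact terminal.hom_ext _ _
    | succ n =>
      change ((c ≫ G.map l) ≫ φ.inv) ≫ φ.hom ≫ G.map (coalgebraToChain G φ.hom n) =
        c ≫ G.map (coalgebraToChain G c n)
      rw [Category.assoc, Iso.inv_hom_id_assoc, Category.assoc, ← G.map_comp, fac]
  -- A homomorphism is determined after each projection, by induction along the chain.
  · refine hom_ext fun n => ?_
    rw [fac]
    induction n with
    | zero => exact terminal.hom_ext _ _
    | succ n ih =>
      change m ≫ φ.hom ≫ G.map (coalgebraToChain G φ.hom n) =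
        c ≫ G.map (coalgebraToChain G c n)
      rw [← ih, G.map_comp, ← Category.assoc, ← hm, Category.assoc]

end Chain

/-! ### Inversion of `α`-conversion on finite trees. -/

namespace LambdaTree

namespace FinTree

variable {Var : Type u}

lemma exists_finset_free (t : FinTree Var) : ∃ S : Finset Var, ∀ x, Free x t → x ∈ S := by
  classical
  induction t with
  | bot => exact ⟨∅, fun _ h => h.elim⟩
  | var x => exact ⟨{x}, fun y h => Finset.mem_singleton.2 h⟩
  | app s t ihs iht =>
    obtain ⟨S, hS⟩ := ihs
    obtain ⟨T, hT⟩ := iht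
    exact ⟨S ∪ T, fun x h => Finset.mem_union.2 (h.imp (hS x) (hT x))⟩
  | lam y t ih =>
    obtain ⟨S, hS⟩ := ih
    exact ⟨S, fun x h => hS x h.2⟩

variable [Infinite Var]

/-- Relabelling is invariant under `α`-conversion and, when `S` contains the free variables, stays
in the `α`-class. This turns a generated equivalence into an equality of trees, to which injectivity
of constructors applies. -/
lemma alpha_iff_relabel_eq {s t : FinTree Var} {S : Finset Var} (hs : ∀ x, Free x s → x ∈ S)
    (ht : ∀ x, Free x t → x ∈ S) : Alpha s t ↔ relabel id S s = relabel id S t :=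
  ⟨fun h => h.relabel_eq id S, fun h =>
    (alpha_relabel_id hs).symm.trans (h ▸ alpha_relabel_id ht)⟩

lemma exists_relabel_eq_of_alpha {s t : FinTree Var} (h : Alpha s t) :
    ∃ S : Finset Var, (∀ x, Free x s → x ∈ S) ∧ (∀ x, Free x t → x ∈ S) ∧
      relabel id S s = relabel id S t := by
  classical
  obtain ⟨S, hS⟩ := exists_finset_free s
  obtain ⟨T, hT⟩ := exists_finset_free t
  exact ⟨S ∪ T, fun x hx => Finset.mem_union_left _ (hS x hx),
    fun x hx => Finset.mem_union_right _ (hT x hx), h.relabel_eq _ _⟩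

lemma alpha_var_iff {x y : Var} : Alpha (var x) (var y) ↔ x = y := by
  refine ⟨fun h => ?_, fun h => h ▸ .refl _⟩
  -- Invariance of `relabel` holds for every set, so `∅` suffices here.
  have := h.relabel_eq id ∅
  simpa [relabel] using this

lemma alpha_app_iff {s s' t t' : FinTree Var} :
    Alpha (app s t) (app s' t') ↔ Alpha s s' ∧ Alpha t t' := by
  refine ⟨fun h => ?_, fun h => .app h.1 h.2⟩
  obtain ⟨S, h1, h2, e⟩ := exists_relabel_eq_of_alpha h
  simp only [relabel, FinTree.app.injEq] at e
  exact ⟨(alpha_iff_relabel_eq (fun x hx => h1 x (.inl hx)) fun x hx => h2 x (.inl hx)).2 e.1,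
    (alpha_iff_relabel_eq (fun x hx => h1 x (.inr hx)) fun x hx => h2 x (.inr hx)).2 e.2⟩

lemma alpha_lam_iff {y : Var} {s t : FinTree Var} :
    Alpha (lam y s) (lam y t) ↔ Alpha s t := by
  classical
  refine ⟨fun h => ?_, .lam y⟩
  obtain ⟨S, h1, h2, e⟩ := exists_relabel_eq_of_alpha h
  simp only [relabel, FinTree.lam.injEq, true_and] at e
  have haS := fresh_notMem S
  generalize fresh S = a at haS e
  -- The normal forms compare the bodies only after `y` is renamed to `a`. Renaming `a` back to `y`
  -- undoes this, as `a ∉ S` differs from all other free variables.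
  have back : ∀ r : FinTree Var, (∀ x, Free x (lam y r) → x ∈ S) →
      relabel (Function.update id a y) (insert y S)
        (relabel (Function.update id y a) (insert a S) r) = relabel id (insert y S) r := by
    intro r hr
    rw [relabel_relabel]
    · refine relabel_congr fun x hx => ?_
      by_cases hxy : x = y
      · simp [hxy]
      · have : x ≠ a := fun e => haS (e ▸ hr x ⟨hxy, hx⟩)
        simp [Function.update_of_ne hxy, Function.update_of_ne this]
    · intro x hx
      by_cases hxy : x = y
      · simp [hxy]
      · simp [Function.update_of_ne hxy, hr x ⟨hxy, hx⟩]
  have mem : ∀ r : FinTree Var, (∀ x, Free x (lam y r) → x ∈ S) →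
      ∀ x, Free x r → x ∈ insert y S := by
    intro r hr x hx
    by_cases hxy : x = y
    · simp [hxy]
    · simp [hr x ⟨hxy, hx⟩]
  rw [alpha_iff_relabel_eq (mem s h1) (mem t h2), ← back s h1, ← back t h2, e]

lemma not_alpha_var_app {x : Var} {s t : FinTree Var} : ¬ Alpha (var x) (app s t) := fun h => by
  simpa [relabel] using h.relabel_eq id ∅

lemma not_alpha_var_lam {x y : Var} {t : FinTree Var} : ¬ Alpha (var x) (lam y t) := fun h => by
  simpa [relabel] using h.relabel_eq id ∅

lemma not_alpha_app_lam {y : Var} {s t r : FinTree Var} : ¬ Alpha (app s t) (lam y r) :=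
  fun h => by simpa [relabel] using h.relabel_eq id ∅

end FinTree

/-! ### Gluing infinite trees from coherent cuttings. -/

namespace Tree

variable {Var : Type u}

/-- The approximation of depth `n` of a tree, as an element of an M-type. -/
def approx (n : ℕ) (t : Tree Var) : PFunctor.Approx.CofixA (sig Var) n :=
  PFunctor.MIntl.approx t n

lemma approx_var (n : ℕ) (x : Var) : approx (n + 1) (var x) =
    .intro (F := sig Var) (Label.var x) (fun i : Empty => i.elim) :=
  congrArg (PFunctor.Approx.CofixA.intro (F := sig Var) (Label.var x))
    (funext fun i => Empty.elim i)

lemma approx_app (n : ℕ) (s t : Tree Var) : approx (n + 1) (app s t) =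
    .intro (F := sig Var) Label.app (fun i : Bool => approx n (bif i then t else s)) := rfl

lemma approx_lam (n : ℕ) (y : Var) (t : Tree Var) : approx (n + 1) (lam y t) =
    .intro (F := sig Var) (Label.lam y) (fun _ : Unit => approx n t) := rfl

/-- Both truncations retain the labels above level `n`. This gives access to the construction of an
M-type element from coherent approximations. -/
lemma cut_eq_iff_approx_eq (n : ℕ) : ∀ s t : Tree Var,
    cut n s = cut n t ↔ approx n s = approx n t := by
  induction n with
  | zero =>
    exact fun s t => ⟨fun _ => Subsingleton.elim (α := PFunctor.Approx.CofixA (sig Var) 0) _ _,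
      fun _ => rfl⟩
  | succ n ih =>
    intro s t
    obtain ⟨x, rfl⟩ | ⟨s, s', rfl⟩ | ⟨y, s, rfl⟩ := cases_tree s <;>
    obtain ⟨z, rfl⟩ | ⟨t, t', rfl⟩ | ⟨z, t, rfl⟩ := cases_tree t <;>
    simp only [cut_var, cut_app, cut_lam, approx_var, approx_app, approx_lam, reduceCtorEq,
      false_iff, FinTree.var.injEq, FinTree.app.injEq, FinTree.lam.injEq, ih]
    · refine ⟨fun h => by rw [h], fun h => ?_⟩
      injection h with _ h1 h2
      injection h1
    · intro h; injection h with _ h1; injection h1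
    · intro h; injection h with _ h1; injection h1
    · intro h; injection h with _ h1; injection h1
    · constructor
      · rintro ⟨h1, h2⟩
        congr 1
        funext i
        cases i using Bool.casesOn
        · exact h1
        · exact h2
      · intro h
        injection h with _ h1 h2
        exact ⟨congrFun h2 false, congrFun h2 true⟩
    · intro h; injection h with _ h1; injection h1
    · intro h; injection h with _ h1; injection h1
    · intro h; injection h with _ h1; injection h1
    · constructor
      · rintro ⟨rfl, h⟩
        rw [h]
      · intro h
        injection h with _ h1 h2
        injection h1 with h1
        subst h1
        exact ⟨rfl, congrFun h2 ()⟩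

/-- A sequence of trees with coherent cuttings has a limit. -/
lemma exists_cut_eq (r : ℕ → Tree Var) (hr : ∀ n, cut n (r n) = cut n (r (n + 1))) :
    ∃ t : Tree Var, ∀ n, cut n t = cut n (r n) := by
  -- Once `approx n (r n)` is replaced by `approx n (r (n + 1))`, both approximations come from the
  -- single tree `r (n + 1)`.
  have hc : ∀ n, PFunctor.Approx.Agree (approx n (r n)) (approx (n + 1) (r (n + 1))) := by
    intro n
    rw [(cut_eq_iff_approx_eq n _ _).1 (hr n)]
    exact PFunctor.MIntl.consistent (r (n + 1)) n
  exact ⟨(⟨fun n => approx n (r n), hc⟩ : PFunctor.MIntl (sig Var)),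
    fun n => (cut_eq_iff_approx_eq n _ _).2 rfl⟩

/-- A free occurrence sits at finite depth, so the context of a glued tree can be checked on its
cuttings. -/
lemma Free.exists_cut {x : Var} {t : Tree Var} (h : Free x t) : ∃ k, (cut k t).Free x := by
  induction h with
  | var => exact ⟨1, rfl⟩
  | app_left t _ ih => exact ih.elim fun k hk => ⟨k + 1, .inl hk⟩
  | app_right s _ ih => exact ih.elim fun k hk => ⟨k + 1, .inr hk⟩
  | lam hne _ ih => exact ih.elim fun k hk => ⟨k + 1, hne, hk⟩

end Tree

end LambdaTree

/-! ### Coproducts of presheaves in each context, and the three kinds of nodes of `H_λ X + V`. -/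

namespace LambdaTree

section CoprodPresheaf

variable {J : Type w} [Category.{v} J] (F G : J ⥤ Type u) (j : J)

/-- Evaluation preserves colimits, so the abstract coproduct is a disjoint union of sets at each
object. The lemmas below extract injectivity, disjointness and exhaustion. -/
lemma nonempty_isColimit_coprod_eval : Nonempty (IsColimit (BinaryCofan.mk
    ((coprod.inl : F ⟶ F ⨿ G).app j) ((coprod.inr : G ⟶ F ⨿ G).app j))) :=
  ⟨mapIsColimitOfPreservesOfIsColimit ((evaluation J (Type u)).obj j) _ _
    (coprodIsCoprod F G)⟩

lemma coprod_inl_app_injective : Function.Injective ((coprod.inl : F ⟶ F ⨿ G).app j) :=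
  ((Types.binaryCofan_isColimit_iff _).1 (nonempty_isColimit_coprod_eval F G j)).1

lemma coprod_inr_app_injective : Function.Injective ((coprod.inr : G ⟶ F ⨿ G).app j) :=
  ((Types.binaryCofan_isColimit_iff _).1 (nonempty_isColimit_coprod_eval F G j)).2.1

lemma coprod_app_isCompl : IsCompl (Set.range ((coprod.inl : F ⟶ F ⨿ G).app j))
    (Set.range ((coprod.inr : G ⟶ F ⨿ G).app j)) :=
  ((Types.binaryCofan_isColimit_iff _).1 (nonempty_isColimit_coprod_eval F G j)).2.2

lemma coprod_inl_app_ne_inr_app (x : F.obj j) (y : G.obj j) :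
    (coprod.inl : F ⟶ F ⨿ G).app j x ≠ (coprod.inr : G ⟶ F ⨿ G).app j y := fun h =>
  Set.disjoint_left.1 (coprod_app_isCompl F G j).disjoint ⟨x, rfl⟩ ⟨y, h.symm⟩

lemma coprod_app_cases (z : (F ⨿ G).obj j) :
    (∃ x, z = (coprod.inl : F ⟶ F ⨿ G).app j x) ∨
      ∃ y, z = (coprod.inr : G ⟶ F ⨿ G).app j y := by
  have h : z ∈ Set.range ((coprod.inl : F ⟶ F ⨿ G).app j) ∪
      Set.range ((coprod.inr : G ⟶ F ⨿ G).app j) := by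
    exact (coprod_app_isCompl F G j).sup_eq_top.ge (Set.mem_univ z)
  exact h.imp (fun ⟨x, hx⟩ => ⟨x, hx.symm⟩) fun ⟨y, hy⟩ => ⟨y, hy.symm⟩

end CoprodPresheaf

variable {Var : Type u} [Infinite Var]

/-- The endofunctor `H_λ(-) + V`. -/
noncomputable abbrev HlamV (Var : Type u) [Infinite Var] : Presheaf Var ⥤ Presheaf Var :=
  addConst Hlam (varPresheaf Var)

section Nodes

variable {X Z : Presheaf Var} {Γ : Ctx Var}

/-- An application node with children in `X`. -/
noncomputable def appNode (a b : X.obj Γ) : ((HlamV Var).obj X).obj Γ :=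
  (coprod.inl : Hlam.obj X ⟶ Hlam.obj X ⨿ varPresheaf Var).app Γ
    (Sum.inl (a, b) : (X.obj Γ × X.obj Γ) ⊕ (delta.obj X).obj Γ)

/-- An abstraction node with child in `X`. -/
noncomputable def lamNode (a : X.obj (Ctx.addOne.obj Γ)) : ((HlamV Var).obj X).obj Γ :=
  (coprod.inl : Hlam.obj X ⟶ Hlam.obj X ⨿ varPresheaf Var).app Γ
    (Sum.inr a : (X.obj Γ × X.obj Γ) ⊕ (delta.obj X).obj Γ)

/-- A variable as a node. -/
noncomputable def varNode (X : Presheaf Var) {Γ : Ctx Var} (x : (varPresheaf Var).obj Γ) :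
    ((HlamV Var).obj X).obj Γ :=
  (coprod.inr : varPresheaf Var ⟶ Hlam.obj X ⨿ varPresheaf Var).app Γ x

lemma appNode_inj {a b a' b' : X.obj Γ} :
    appNode a b = appNode a' b' ↔ a = a' ∧ b = b' := by
  refine ⟨fun h => ?_, fun h => by rw [h.1, h.2]⟩
  have h := coprod_inl_app_injective _ _ _ h
  exact Prod.mk.inj (Sum.inl.inj h)

lemma lamNode_inj {a a' : X.obj (Ctx.addOne.obj Γ)} : lamNode a = lamNode a' ↔ a = a' := by
  refine ⟨fun h => ?_, fun h => by rw [h]⟩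
  have h := coprod_inl_app_injective _ _ _ h
  exact Sum.inr.inj h

lemma varNode_inj {x x' : (varPresheaf Var).obj Γ} : varNode X x = varNode X x' ↔ x = x' :=
  (coprod_inr_app_injective _ _ _).eq_iff

lemma appNode_ne_lamNode {a b : X.obj Γ} {c : X.obj (Ctx.addOne.obj Γ)} :
    appNode a b ≠ lamNode c := fun h =>
  Sum.inl_ne_inr (coprod_inl_app_injective _ _ _ h)

lemma appNode_ne_varNode {a b : X.obj Γ} {x : (varPresheaf Var).obj Γ} :
    appNode a b ≠ varNode X x := coprod_inl_app_ne_inr_app _ _ _ _ _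

lemma lamNode_ne_varNode {a : X.obj (Ctx.addOne.obj Γ)} {x : (varPresheaf Var).obj Γ} :
    lamNode a ≠ varNode X x := coprod_inl_app_ne_inr_app _ _ _ _ _

lemma node_cases (z : ((HlamV Var).obj X).obj Γ) :
    (∃ a b, z = appNode a b) ∨ (∃ a, z = lamNode a) ∨ ∃ x, z = varNode X x := by
  obtain ⟨h, rfl⟩ | ⟨x, rfl⟩ := coprod_app_cases _ _ _ z
  · obtain ⟨a, b⟩ | a := h
    · exact Or.inl ⟨a, b, rfl⟩
    · exact Or.inr (Or.inl ⟨a, rfl⟩)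
  · exact Or.inr (Or.inr ⟨x, rfl⟩)

lemma map_inl_app (f : X ⟶ Z) (h : (Hlam.obj X).obj Γ) :
    ((HlamV Var).map f).app Γ
        ((coprod.inl : Hlam.obj X ⟶ Hlam.obj X ⨿ varPresheaf Var).app Γ h) =
      (coprod.inl : Hlam.obj Z ⟶ Hlam.obj Z ⨿ varPresheaf Var).app Γ ((Hlam.map f).app Γ h) :=
  ConcreteCategory.congr_hom (congrArg (fun g => NatTrans.app g Γ)
    (coprod.inl_map (Hlam.map f) (𝟙 (varPresheaf Var)))) h

lemma map_appNode (f : X ⟶ Z) (a b : X.obj Γ) :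
    ((HlamV Var).map f).app Γ (appNode a b) = appNode (f.app Γ a) (f.app Γ b) :=
  map_inl_app f _

lemma map_lamNode (f : X ⟶ Z) (a : X.obj (Ctx.addOne.obj Γ)) :
    ((HlamV Var).map f).app Γ (lamNode a) = lamNode (f.app _ a) :=
  map_inl_app f _

lemma map_varNode (f : X ⟶ Z) (x : (varPresheaf Var).obj Γ) :
    ((HlamV Var).map f).app Γ (varNode X x) = varNode Z x :=
  ConcreteCategory.congr_hom (congrArg (fun g => NatTrans.app g Γ)
    (coprod.inr_map (Hlam.map f) (𝟙 (varPresheaf Var)))) x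

lemma map_app_surjective (f : X ⟶ Z) (hf : ∀ Γ, Function.Surjective (f.app Γ)) (Γ : Ctx Var) :
    Function.Surjective (((HlamV Var).map f).app Γ) := by
  intro z
  obtain ⟨a, b, rfl⟩ | ⟨a, rfl⟩ | ⟨x, rfl⟩ := node_cases z
  · obtain ⟨a, rfl⟩ := hf _ a
    obtain ⟨b, rfl⟩ := hf _ b
    exact ⟨_, map_appNode f a b⟩
  · obtain ⟨a, rfl⟩ := hf _ a
    exact ⟨_, map_lamNode f a⟩
  · exact ⟨_, map_varNode f x⟩

end Nodes

/-! ### Bijectivity of `[τ, i]`, and the kernel of `H_λ f + V`. -/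

section TermStructure

variable {Γ : Ctx Var}

/-- The morphism `[τ, i] : H_λ T_λ + V ⟶ T_λ`. -/
noncomputable def termDesc (Var : Type u) [Infinite Var] :
    (HlamV Var).obj (Tlam Var) ⟶ Tlam Var :=
  coprod.desc (TlamAlgebra Var).str (varTlam Var)

lemma termDesc_appNode (s t : TreeIn Γ) :
    (termDesc Var).app Γ (appNode (X := Tlam Var) (⟦s⟧ : Term Γ) (⟦t⟧ : Term Γ)) =
      (⟦TreeIn.app s t⟧ : Term Γ) :=
  ConcreteCategory.congr_hom (congrArg (fun g => NatTrans.app g Γ)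
    (coprod.inl_desc (TlamAlgebra Var).str (varTlam Var))) _

lemma termDesc_lamNode (t : TreeIn (Ctx.addOne.obj Γ)) :
    (termDesc Var).app Γ (lamNode (X := Tlam Var) (⟦t⟧ : Term (Ctx.addOne.obj Γ))) =
      (⟦TreeIn.lam t⟧ : Term Γ) :=
  ConcreteCategory.congr_hom (congrArg (fun g => NatTrans.app g Γ)
    (coprod.inl_desc (TlamAlgebra Var).str (varTlam Var))) _

lemma termDesc_varNode (x : (varPresheaf Var).obj Γ) :
    (termDesc Var).app Γ (varNode (Tlam Var) x) = (⟦TreeIn.var x⟧ : Term Γ) :=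
  ConcreteCategory.congr_hom (congrArg (fun g => NatTrans.app g Γ)
    (coprod.inr_desc (TlamAlgebra Var).str (varTlam Var))) _

omit [Infinite Var] in
lemma TreeIn.mk_eq_iff {s t : TreeIn Γ} : (⟦s⟧ : Term Γ) = ⟦t⟧ ↔
    ∀ k, FinTree.Alpha (Tree.cut k s.1) (Tree.cut k t.1) := Quotient.eq

lemma mem_vars_addOne {x : Var} :
    x ∈ (Ctx.addOne.obj Γ).vars ↔ x = fresh Γ.vars ∨ x ∈ Γ.vars := by
  classical
  exact Finset.mem_insert

lemma tree_node_cases (z : ((HlamV Var).obj (Tlam Var)).obj Γ) :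
    (∃ s t : TreeIn Γ, z = appNode (X := Tlam Var) (⟦s⟧ : Term Γ) (⟦t⟧ : Term Γ)) ∨
      (∃ t : TreeIn (Ctx.addOne.obj Γ),
        z = lamNode (X := Tlam Var) (⟦t⟧ : Term (Ctx.addOne.obj Γ))) ∨
      ∃ x, z = varNode (Tlam Var) x := by
  obtain ⟨a, b, rfl⟩ | ⟨a, rfl⟩ | ⟨x, rfl⟩ := node_cases z
  · induction a using Quotient.inductionOn with
    | h a =>
    induction b using Quotient.inductionOn with
    | h b => exact Or.inl ⟨a, b, rfl⟩
  · induction a using Quotient.inductionOn with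
    | h a => exact Or.inr (Or.inl ⟨a, rfl⟩)
  · exact Or.inr (Or.inr ⟨x, rfl⟩)

lemma termDesc_surjective (Γ : Ctx Var) : Function.Surjective ((termDesc Var).app Γ) := by
  classical
  intro t
  induction t using Quotient.inductionOn with
  | h t =>
  obtain ⟨t, ht⟩ := t
  obtain ⟨x, rfl⟩ | ⟨s, s', rfl⟩ | ⟨y, s, rfl⟩ := Tree.cases_tree t
  · exact ⟨_, termDesc_varNode (⟨x, ht x .var⟩ : {x : Var // x ∈ Γ.vars})⟩
  · exact ⟨_, termDesc_appNode (Γ := Γ) ⟨s, fun x hx => ht x (.app_left _ hx)⟩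
      ⟨s', fun x hx => ht x (.app_right _ hx)⟩⟩
  -- The binder `y` need not be the variable that `TreeIn.lam` abstracts. Relabelling along `id`
  -- renames it to `fresh Γ.vars` within the `α`-class, and the body of the result is the preimage.
  · have hr := Tree.relabel_lam id Γ.vars y s
    refine ⟨_, (termDesc_lamNode (Γ := Γ) ⟨_, fun x hx => ?_⟩).trans
      (Quotient.sound (a := TreeIn.lam ⟨Tree.relabel (Function.update id y (fresh Γ.vars))
        (insert (fresh Γ.vars) Γ.vars) s, _⟩) ?_)⟩
    · obtain ⟨z, hz, rfl⟩ := Tree.free_relabel hx _ _ _ rfl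
      rw [mem_vars_addOne]
      by_cases hzy : z = y
      · subst hzy
        exact Or.inl (Function.update_self _ _ _)
      · rw [Function.update_of_ne hzy]
        exact Or.inr (ht z (.lam hzy hz))
    · intro k
      change FinTree.Alpha (Tree.cut k (Tree.lam _ _)) _
      rw [← hr, Tree.cut_relabel]
      exact FinTree.alpha_relabel_id fun x hx => ht x (Tree.free_of_free_cut k hx)

/-- If the kernel of `f` is `α`-equivalence of the cuttings at level `n`, then the kernel of
`H_λ f + V` is `α`-equivalence of the cuttings at level `n + 1`. -/
lemma map_eq_map_iff {Z : Presheaf Var} (f : Tlam Var ⟶ Z) (n : ℕ)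
    (hf : ∀ (Γ : Ctx Var) (s t : TreeIn Γ), f.app Γ (⟦s⟧ : Term Γ) = f.app Γ (⟦t⟧ : Term Γ) ↔
      FinTree.Alpha (Tree.cut n s.1) (Tree.cut n t.1))
    (z z' : ((HlamV Var).obj (Tlam Var)).obj Γ) (s t : TreeIn Γ)
    (hs : (termDesc Var).app Γ z = (⟦s⟧ : Term Γ))
    (ht : (termDesc Var).app Γ z' = (⟦t⟧ : Term Γ)) :
    ((HlamV Var).map f).app Γ z = ((HlamV Var).map f).app Γ z' ↔
      FinTree.Alpha (Tree.cut (n + 1) s.1) (Tree.cut (n + 1) t.1) := by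
  have congr_left : ∀ {a b c : FinTree Var}, FinTree.Alpha a b →
      (FinTree.Alpha a c ↔ FinTree.Alpha b c) :=
    fun h => ⟨h.symm.trans, h.trans⟩
  have congr_right : ∀ {a b c : FinTree Var}, FinTree.Alpha a b →
      (FinTree.Alpha c a ↔ FinTree.Alpha c b) :=
    fun h => ⟨fun h' => h'.trans h, fun h' => h'.trans h.symm⟩
  have map_app : ∀ a b : TreeIn Γ, ((HlamV Var).map f).app Γ
      (appNode (X := Tlam Var) (⟦a⟧ : Term Γ) (⟦b⟧ : Term Γ)) =
        appNode (f.app Γ (⟦a⟧ : Term Γ)) (f.app Γ (⟦b⟧ : Term Γ)) :=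
    fun a b => map_appNode f _ _
  have map_lam : ∀ a : TreeIn (Ctx.addOne.obj Γ), ((HlamV Var).map f).app Γ
      (lamNode (X := Tlam Var) (⟦a⟧ : Term (Ctx.addOne.obj Γ))) =
        lamNode (f.app _ (⟦a⟧ : Term (Ctx.addOne.obj Γ))) :=
    fun a => map_lamNode f _
  obtain ⟨a, b, rfl⟩ | ⟨a, rfl⟩ | ⟨x, rfl⟩ := tree_node_cases z <;>
  obtain ⟨a', b', rfl⟩ | ⟨a', rfl⟩ | ⟨x', rfl⟩ := tree_node_cases z' <;>
  simp only [termDesc_appNode, termDesc_lamNode, termDesc_varNode] at hs ht <;>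
  -- The trees `s` and `t` are only `α`-equivalent to those built from the nodes, so they are
  -- replaced by these, whose root is visible to `cut`.
  rw [← congr_left (TreeIn.mk_eq_iff.1 hs (n + 1)),
    ← congr_right (TreeIn.mk_eq_iff.1 ht (n + 1))] <;>
  simp only [map_app, map_lam, map_varNode, appNode_inj, lamNode_inj, varNode_inj, hf,
    TreeIn.app, TreeIn.lam, TreeIn.var, Tree.cut_app, Tree.cut_lam, Tree.cut_var,
    FinTree.alpha_app_iff, FinTree.alpha_lam_iff, FinTree.alpha_var_iff]
  · exact iff_of_false appNode_ne_lamNode FinTree.not_alpha_app_lam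
  · exact iff_of_false appNode_ne_varNode fun h => FinTree.not_alpha_var_app h.symm
  · exact iff_of_false appNode_ne_lamNode.symm fun h => FinTree.not_alpha_app_lam h.symm
  · exact iff_of_false lamNode_ne_varNode fun h => FinTree.not_alpha_var_lam h.symm
  · exact iff_of_false appNode_ne_varNode.symm FinTree.not_alpha_var_app
  · exact iff_of_false lamNode_ne_varNode.symm FinTree.not_alpha_var_lam
  · exact Subtype.ext_iff

lemma termDesc_injective (Γ : Ctx Var) : Function.Injective ((termDesc Var).app Γ) := by
  intro z z' h
  obtain ⟨a, b, rfl⟩ | ⟨a, rfl⟩ | ⟨x, rfl⟩ := tree_node_cases z <;>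
  obtain ⟨a', b', rfl⟩ | ⟨a', rfl⟩ | ⟨x', rfl⟩ := tree_node_cases z' <;>
  simp only [termDesc_appNode, termDesc_lamNode, termDesc_varNode] at h <;>
  -- Level `0` carries no information. Levels `k + 1` expose the root and give the subtrees at all
  -- levels `k`; differing roots already conflict at level `1`.
  replace h := fun k => TreeIn.mk_eq_iff.1 h (k + 1) <;>
  simp only [TreeIn.app, TreeIn.lam, TreeIn.var, Tree.cut_app, Tree.cut_lam, Tree.cut_var,
    FinTree.alpha_app_iff, FinTree.alpha_lam_iff, FinTree.alpha_var_iff] at h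
  · exact appNode_inj.2 ⟨TreeIn.mk_eq_iff.2 fun k => (h k).1, TreeIn.mk_eq_iff.2 fun k => (h k).2⟩
  · exact (FinTree.not_alpha_app_lam (h 0)).elim
  · exact (FinTree.not_alpha_var_app (h 0).symm).elim
  · exact (FinTree.not_alpha_app_lam (h 0).symm).elim
  · exact lamNode_inj.2 (TreeIn.mk_eq_iff.2 h)
  · exact (FinTree.not_alpha_var_lam (h 0).symm).elim
  · exact (FinTree.not_alpha_var_app (h 0)).elim
  · exact (FinTree.not_alpha_var_lam (h 0)).elim
  · exact varNode_inj.2 (Subtype.ext (h 0))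

instance isIso_termDesc : IsIso (termDesc Var) := by
  rw [NatTrans.isIso_iff_isIso_app]
  intro Γ
  rw [isIso_iff_bijective]
  exact ⟨termDesc_injective Γ, termDesc_surjective Γ⟩

end TermStructure

/-! ### The canonical maps as cuttings, and `T_λ` as the limit of the chain. -/

section Chain

/-- The isomorphism `T_λ ≅ H_λ T_λ + V` inverse to `[τ, i]`. -/
noncomputable def termIso (Var : Type u) [Infinite Var] :
    Tlam Var ≅ (HlamV Var).obj (Tlam Var) :=
  (asIso (termDesc Var)).symm

/-- The cutting at level `n` as a morphism to the `n`-th object of the terminal-coalgebra chain. -/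
noncomputable abbrev cutting (Var : Type u) [Infinite Var] (n : ℕ) :
    Tlam Var ⟶ chainObj (HlamV Var) n :=
  coalgebraToChain (HlamV Var) (termIso Var).hom n

lemma termDesc_cutting (n : ℕ) :
    termDesc Var ≫ cutting Var (n + 1) = (HlamV Var).map (cutting Var n) :=
  (termIso Var).inv_hom_id_assoc _

lemma cutting_succ_termDesc (n : ℕ) {Γ : Ctx Var} (z : ((HlamV Var).obj (Tlam Var)).obj Γ) :
    (cutting Var (n + 1)).app Γ ((termDesc Var).app Γ z) =
      ((HlamV Var).map (cutting Var n)).app Γ z :=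
  ConcreteCategory.congr_hom (congrArg (fun g => NatTrans.app g Γ) (termDesc_cutting n)) z

instance terminal_obj_subsingleton (Γ : Ctx Var) : Subsingleton ((⊤_ (Presheaf Var)).obj Γ) :=
  (Types.isTerminalEquivUnique _
    (terminalIsTerminal.isTerminalObj ((evaluation (Ctx Var) (Type u)).obj Γ) _)).instSubsingleton

lemma cutting_eq_iff (n : ℕ) : ∀ (Γ : Ctx Var) (s t : TreeIn Γ),
    (cutting Var n).app Γ (⟦s⟧ : Term Γ) = (cutting Var n).app Γ (⟦t⟧ : Term Γ) ↔
      FinTree.Alpha (Tree.cut n s.1) (Tree.cut n t.1) := by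
  induction n with
  | zero =>
    exact fun Γ s t => iff_of_true
      (Subsingleton.elim (α := (⊤_ (Presheaf Var)).obj Γ) _ _) (.refl _)
  | succ n ih =>
    intro Γ s t
    obtain ⟨z, hz⟩ := termDesc_surjective Γ (⟦s⟧ : Term Γ)
    obtain ⟨z', hz'⟩ := termDesc_surjective Γ (⟦t⟧ : Term Γ)
    rw [← hz, ← hz', cutting_succ_termDesc, cutting_succ_termDesc]
    exact map_eq_map_iff _ n ih z z' s t hz hz'

lemma cutting_surjective (n : ℕ) : ∀ Γ : Ctx Var, Function.Surjective ((cutting Var n).app Γ) := by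
  induction n with
  | zero =>
    intro Γ z
    -- `W₀` is a singleton in each context, so only some term is needed; `λx.x` is closed and
    -- therefore exists even in the empty context.
    refine ⟨(⟦TreeIn.lam (TreeIn.var ⟨fresh Γ.vars, mem_vars_addOne.2 (Or.inl rfl)⟩)⟧ : Term Γ),
      Subsingleton.elim (α := (⊤_ (Presheaf Var)).obj Γ) _ _⟩
  | succ n ih =>
    intro Γ z
    obtain ⟨y, hy⟩ := map_app_surjective (cutting Var n) ih Γ z
    exact ⟨_, (cutting_succ_termDesc n y).trans hy⟩

/-- The terms in a context are the compatible families of cuttings. -/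
lemma existsUnique_cutting_eq (Γ : Ctx Var) (w : ∀ n, (chainObj (HlamV Var) n).obj Γ)
    (hw : ∀ n, (chainMap (HlamV Var) n).app Γ (w (n + 1)) = w n) :
    ∃! t : (Tlam Var).obj Γ, ∀ n, (cutting Var n).app Γ t = w n := by
  have hex : ∀ n, ∃ s : TreeIn Γ, (cutting Var n).app Γ (⟦s⟧ : Term Γ) = w n := fun n => by
    obtain ⟨s, hs⟩ := cutting_surjective n Γ (w n)
    obtain ⟨s, rfl⟩ := Quotient.exists_rep s
    exact ⟨s, hs⟩
  choose s hs using hex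
  have hfree : ∀ n k x, (Tree.cut k (s n).1).Free x → x ∈ Γ.vars :=
    fun n k x hx => (s n).2 x (Tree.free_of_free_cut k hx)
  -- Compatibility of the family becomes `α`-equivalence of cuttings through the kernel of the
  -- `n`-th map.
  have halpha : ∀ n, FinTree.Alpha (Tree.cut n (s n).1) (Tree.cut n (s (n + 1)).1) := by
    intro n
    rw [← cutting_eq_iff n Γ, hs, ← hw n, ← hs (n + 1)]
    exact ConcreteCategory.congr_hom (congrArg (fun g => NatTrans.app g Γ)
      (coalgebraToChain_chainMap (HlamV Var) (termIso Var).hom n)) _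
  -- Gluing needs equal cuttings, not `α`-equivalent ones. The single set `Γ.vars` normalizes all
  -- representatives simultaneously.
  obtain ⟨t, ht⟩ := Tree.exists_cut_eq (fun n => Tree.relabel id Γ.vars (s n).1) fun n => by
    rw [Tree.cut_relabel, Tree.cut_relabel, (halpha n).relabel_eq]
  have htΓ : ∀ x, Tree.Free x t → x ∈ Γ.vars := by
    intro x hx
    obtain ⟨k, hk⟩ := hx.exists_cut
    rw [ht, Tree.cut_relabel] at hk
    obtain ⟨y, hy, rfl⟩ := FinTree.free_relabel hk
    exact hfree k k y hy
  have htcut : ∀ n, FinTree.Alpha (Tree.cut n t) (Tree.cut n (s n).1) := by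
    intro n
    rw [ht, Tree.cut_relabel]
    exact FinTree.alpha_relabel_id (hfree n n)
  refine ⟨(⟦⟨t, htΓ⟩⟧ : Term Γ),
    fun n => ((cutting_eq_iff n Γ ⟨t, htΓ⟩ (s n)).2 (htcut n)).trans (hs n), fun t' ht' => ?_⟩
  obtain ⟨t', rfl⟩ := Quotient.exists_rep t'
  exact TreeIn.mk_eq_iff.2 fun n =>
    ((cutting_eq_iff n Γ t' (s n)).1 ((ht' n).trans (hs n).symm)).trans (htcut n).symm

/-- Limits of presheaves are detected in each context, where a limit of sets is the set of
compatible families. -/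
lemma nonempty_isLimit_cutting : Nonempty (IsLimit
    (Cone.mk (Tlam Var) (coalgebraCone (HlamV Var) (termIso Var).hom))) := by
  refine ⟨evaluationJointlyReflectsLimits _ fun Γ => Nonempty.some ?_⟩
  rw [Types.isLimit_iff]
  intro w hw
  obtain ⟨t, ht, htu⟩ := existsUnique_cutting_eq Γ (fun n => w (op n)) fun n => by
    have h : (terminalCoalgebraChain (HlamV Var)).map (homOfLE (Nat.le_add_right n 1)).op =
        chainMap (HlamV Var) n := Functor.ofOpSequence_map_homOfLE_succ _ n
    rw [← h]
    exact hw (homOfLE (Nat.le_add_right n 1)).op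
  exact ⟨t, fun j => ht j.unop, fun t' ht' => htu t' fun n => ht' (op n)⟩

end Chain

end LambdaTree

theorem theorem2p8 (Var : Type u) [Countable Var] [Infinite Var] :
    -- `T_λ` is the free completely iterative `H_λ`-algebra on `V`
    IsFreeCIA (LambdaTree.TlamAlgebra Var) (LambdaTree.varTlam Var) ∧
    -- the inverse of `[τ, i] : H_λ T_λ + V ⟶ T_λ` makes `T_λ` a terminal coalgebra of `H_λ(-) + V`
    (∃ φ : LambdaTree.Tlam Var ≅
        (addConst LambdaTree.Hlam (LambdaTree.varPresheaf Var)).obj (LambdaTree.Tlam Var),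
      φ.inv = coprod.desc (LambdaTree.TlamAlgebra Var).str (LambdaTree.varTlam Var) ∧
      Nonempty (IsTerminal (⟨LambdaTree.Tlam Var, φ.hom⟩ :
        Endofunctor.Coalgebra (addConst LambdaTree.Hlam (LambdaTree.varPresheaf Var))))) ∧
    -- `T_λ` is the limit of the terminal-coalgebra chain `W` of `H_λ(-) + V`; the limit maps are the
    -- canonical ones, and they are the cuttings at level `n`
    ∃ π : (Functor.const ℕᵒᵖ).obj (LambdaTree.Tlam Var) ⟶
        terminalCoalgebraChain (addConst LambdaTree.Hlam (LambdaTree.varPresheaf Var)),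
      Nonempty (IsLimit (Cone.mk (LambdaTree.Tlam Var) π)) ∧
      (∀ n : ℕ,
        coprod.desc (LambdaTree.TlamAlgebra Var).str (LambdaTree.varTlam Var) ≫
            π.app (op (n + 1)) =
          (addConst LambdaTree.Hlam (LambdaTree.varPresheaf Var)).map (π.app (op n))) ∧
      ∀ (n : ℕ) (Γ : LambdaTree.Ctx Var),
        Function.Surjective ((π.app (op n)).app Γ) ∧
        ∀ s t : LambdaTree.TreeIn Γ,
          (π.app (op n)).app Γ (⟦s⟧ : LambdaTree.Term Γ) =
              (π.app (op n)).app Γ (⟦t⟧ : LambdaTree.Term Γ) ↔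
            LambdaTree.FinTree.Alpha (LambdaTree.Tree.cut n s.1) (LambdaTree.Tree.cut n t.1) := by
  obtain ⟨hL⟩ := LambdaTree.nonempty_isLimit_cutting (Var := Var)
  have hT := fun (K : LambdaTree.Presheaf Var) k =>
    existsUnique_hom_of_isLimit_coalgebraCone (LambdaTree.HlamV Var) (LambdaTree.termIso Var) hL
      (X := K) k
  -- The same unique homomorphisms `hT` give freeness and terminality; the `rfl` is the definition
  -- of `termIso` as the inverse of `[τ, i]`.
  refine ⟨isFreeCIA_of_existsUnique_coalgebra_hom _ _ (LambdaTree.termIso Var) rfl hT,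
    ⟨LambdaTree.termIso Var, rfl, ⟨IsTerminal.ofUniqueHom
      (fun K => ⟨(hT K.V K.str).choose, (hT K.V K.str).choose_spec.1⟩) fun K m => ?_⟩⟩,
    coalgebraCone _ (LambdaTree.termIso Var).hom, ⟨hL⟩, LambdaTree.termDesc_cutting,
    fun n Γ => ⟨LambdaTree.cutting_surjective n Γ, LambdaTree.cutting_eq_iff n Γ⟩⟩
  ext1
  exact (hT K.V K.str).choose_spec.2 m.f m.h
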